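/- Consider a stochastic multi-objective multi-armed bandit with $K\ge 2$ arms and $D\ge 1$ objectives: arm $i$ has a fixed reward law on $[0,1]^D$ with mean vector $\mu^i$. In each round a randomized algorithm draws an arm $a_t$ on the basis of the arms pulled and the rewards observed so far, and observes a reward vector $r^{a_t,t}$ drawn from the law of that arm. Let $\bar O'_T=\{T\mu^i : \text{no arm } j \text{ satisfies } T\mu^j\ge T\mu^i \text{ coordinatewise and } T\mu^j\neq T\mu^i\}$ be the Pareto front, and let $$\bar R'_T=\mathrm{Dist}\Big(\mathbb E\Big[\sum_{t=1}^T r^{a_t,t}\Big],\bar O'_T\Big),$$ where $\mathrm{Dist}(a,O)$ is the least $\varepsilon\ge 0$ such that for every $\sigma\in O$ there are coordinates $d,d'$ with $a_d+\varepsilon\ge\sigma_d$ and $a_{d'}+\varepsilon\le\sigma_{d'}$, be the Pareto pseudo regret. Call an instance coordinate-constant if $\mu^i=(m_i,\dots,m_i)$ for every arm $i$. Call an algorithm (which may depend on the horizon $T$) consistent if $\bar R'_T=o(T^a)$ for every $a>0$ on every coordinate-constant instance. Then, for all $K\ge 2$ and $D\ge 1$: 1. There is a coordinate-constant instance on which every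 consistent algorithm has $\bar R'_T>\log T$ for all sufficiently large $T$. 2. There are two coordinate-constant instances and a $T_0$ such that for every $T\ge T_0$ every randomized algorithm, consistent or not, has $\bar R'_T>\log T$ on at least one of the two. 3. For every coordinate-constant instance with $m_i<1$ for all $i$ whose $m_i$ are not all equal, there is a constant $c>0$ depending only on the instance such that every consistent algorithm satisfies $\liminf_{T\to\infty}\bar R'_T/\log T\ge c$. -/

import Mathlib

open MeasureTheory ProbabilityTheory Filter Asymptotics

noncomputable section

namespace MOMAB

/-- Reward vectors with `D` objectives. The order is the coordinatewise one: `b ≤ a` is weak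
Pareto dominance of `a` over `b`, and `b < a` (that is `b ≤ a` and `b ≠ a`) is Pareto dominance. -/
abbrev Reward (D : ℕ) : Type := Fin D → ℝ

/-- A history of `n` rounds: the arm pulled and the reward vector observed in every round. -/
abbrev Hist (K D n : ℕ) : Type := Fin n → Fin K × Reward D

/-- A stochastic multi-objective bandit with `K` arms and `D` objectives: every arm `i` has a
time-invariant reward law on `[0,1]^D` (arbitrary dependence between the coordinates). -/
structure Instance (K D : ℕ) where
  /-- the law of the reward vector of an arm -/
  law : Fin K → Measure (Reward D)
  isProb : ∀ i, IsProbabilityMeasure (law i)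
  bounded : ∀ i, ∀ᵐ r ∂(law i), ∀ d, r d ∈ Set.Icc (0 : ℝ) 1

/-- A randomized algorithm: given the arms pulled and the rewards observed in the first `n` rounds,
it draws the next arm at random, measurably in that history. -/
structure Algorithm (K D : ℕ) where
  /-- the conditional law of the next arm given the history -/
  next : (n : ℕ) → Kernel (Hist K D n) (Fin K)
  isMarkov : ∀ n, IsMarkovKernel (next n)

variable {K D : ℕ}

namespace Instance

/-- The mean reward vector `μ^i` of arm `i`. -/
def mean (ν : Instance K D) (i : Fin K) : Reward D := fun d => ∫ r, r d ∂(ν.law i)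

/-- Every mean vector is constant across the coordinates: `μ^i = (m_i, …, m_i)`. -/
def ConstantMeans (ν : Instance K D) : Prop := ∀ i d d', ν.mean i d = ν.mean i d'

/-- The reward laws as a kernel from arms to reward vectors. -/
def lawKernel (ν : Instance K D) : Kernel (Fin K) (Reward D) := Kernel.ofFunOfCountable ν.law

instance (ν : Instance K D) : IsMarkovKernel ν.lawKernel := ⟨fun i => ν.isProb i⟩

/-- The cumulative expected reward `∑_{t=1}^T E[r^{i,t}] = T μ^i` of always pulling arm `i`. -/
def cumMean (ν : Instance K D) (T : ℕ) (i : Fin K) : Reward D := (T : ℝ) • ν.mean i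

/-- The Pareto front: cumulative expected rewards of the arms that no other arm dominates. -/
def front (ν : Instance K D) (T : ℕ) : Set (Reward D) :=
  {v | ∃ i, v = ν.cumMean T i ∧ ∀ j, ¬ ν.cumMean T i < ν.cumMean T j}

end Instance

instance (π : Algorithm K D) (n : ℕ) : IsMarkovKernel (π.next n) := π.isMarkov n

/-- One round after `n` rounds: the algorithm draws an arm `a` given the history, then a reward
vector is drawn from the law of arm `a`, independently of the past given `a`. -/
def step (ν : Instance K D) (π : Algorithm K D) (n : ℕ) :
    Kernel (Hist K D n) (Fin K × Reward D) :=
  (π.next n) ⊗ₖ (Kernel.prodMkLeft (Hist K D n) ν.lawKernel)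

/-- The law of the history of the first `n` rounds when `π` plays on `ν`. -/
def histLaw (ν : Instance K D) (π : Algorithm K D) : (n : ℕ) → Measure (Hist K D n)
  | 0 => Measure.dirac (fun t => t.elim0)
  | n + 1 => ((histLaw ν π n) ⊗ₘ (step ν π n)).map
      (fun p => (Fin.snoc (α := fun _ => Fin K × Reward D) p.1 p.2 : Hist K D (n + 1)))

/-- The expected cumulative reward vector `E[∑_{t=1}^T r^{a_t,t}]`. -/
def expectedReward (ν : Instance K D) (π : Algorithm K D) (T : ℕ) : Reward D :=
  fun d => ∫ h, ∑ t, (h t).2 d ∂(histLaw ν π T)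

/-- Neither vector is strictly larger than the other in all coordinates. This is Pareto
incomparability with its boundary cases included. -/
def Incomparable (a b : Reward D) : Prop := (∃ d, b d ≤ a d) ∧ (∃ d, a d ≤ b d)

/-- The Pareto distance: the least `ε ≥ 0` such that `a + ε (1, …, 1)` is incomparable to every
`σ ∈ O`. Incomparability has to include the boundary cases for the minimum to be attained, and for
the admissible set to be non-empty when `a` and `σ` differ by a multiple of `(1, …, 1)`. The value
is the infimum for strict incomparability whenever some `ε ≥ 0` is admissible there. -/
def paretoDist (a : Reward D) (O : Set (Reward D)) : ℝ :=
  sInf {ε : ℝ | 0 ≤ ε ∧ ∀ σ ∈ O, Incomparable (fun d => a d + ε) σ}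

/-- The Pareto pseudo regret of `π` on `ν` at horizon `T`. -/
def pseudoRegret (ν : Instance K D) (π : Algorithm K D) (T : ℕ) : ℝ :=
  paretoDist (expectedReward ν π T) (ν.front T)

/-- The algorithms `π T`, each run up to its horizon `T`, are consistent: on every instance
whose mean vectors are constant across coordinates, the Pareto pseudo regret is `o(T^a)` for every
`a > 0`. An algorithm that does not know the horizon is the case of a constant `π`. -/
def Consistent (π : ℕ → Algorithm K D) : Prop :=
  ∀ ν : Instance K D, ν.ConstantMeans → ∀ a : ℝ, 0 < a →
    (fun T : ℕ => pseudoRegret ν (π T) T) =o[atTop] (fun T : ℕ => (T : ℝ) ^ a)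

end MOMAB

end

/-! When all means lie on the diagonal, the Pareto front is the single point `T * M` times `(1, …,
1)`, with `M` the best mean. The expected reward is also on the diagonal, so the Pareto pseudo
regret is the ordinary scalar one (`pseudoRegret_eq`). What remains is a Lai–Robbins type lower
bound.

Let `ν₁` and `ν₂` differ only in arm `j`, which is suboptimal on `ν₁` and uniquely best on `ν₂`.
Regret at most `c log T` on `ν₁` bounds the expected pulls of `j` there by a multiple of `log T`.
The two histories can then be told apart only at a cost polynomial in `T`: a change of measure
(`le_integral_sub_pulls`) shows that on `ν₂` the other arms are still pulled at least of order `√T`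
times when `c` is small against the divergence. Hence every algorithm has regret above `c log T` on
`ν₁` or at least `T^(1/4)` on `ν₂` (`exists_forall_pseudoRegret_dichotomy`).

A Bernoulli pair with small gaps allows `c = 1`, which gives claims 1 and 2. For claim 3, mixing a
suboptimal arm with the point mass at `(1, …, 1)` makes it best, since all means are below 1; only a
lower bound on the new law by a multiple of the old one is needed. Consistency rules out the
polynomial alternative. -/

namespace MOMAB

variable {K D : ℕ}

/-! ### Integration over histories, one round at a time -/

instance isProbabilityMeasure_law (ν : Instance K D) (i : Fin K) :
    IsProbabilityMeasure (ν.law i) := ν.isProb i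

theorem measurable_snoc (n : ℕ) :
    Measurable (fun p : Hist K D n × (Fin K × Reward D) =>
      (Fin.snoc (α := fun _ => Fin K × Reward D) p.1 p.2 : Hist K D (n + 1))) := by
  rw [measurable_pi_iff]
  intro t
  refine Fin.lastCases ?_ (fun s => ?_) t
  · simpa using measurable_snd
  · simp only [Fin.snoc_castSucc]
    exact (measurable_pi_apply s).comp measurable_fst

instance isMarkovKernel_step (ν : Instance K D) (π : Algorithm K D) (n : ℕ) :
    IsMarkovKernel (step ν π n) := by
  unfold step; infer_instance

instance isProbabilityMeasure_histLaw (ν : Instance K D) (π : Algorithm K D) (n : ℕ) :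
    IsProbabilityMeasure (histLaw ν π n) := by
  induction n with
  | zero => unfold histLaw; infer_instance
  | succ n ih =>
    unfold histLaw
    exact Measure.isProbabilityMeasure_map (measurable_snoc n).aemeasurable

theorem lintegral_step (ν : Instance K D) (π : Algorithm K D) {n : ℕ} (h : Hist K D n)
    {f : Fin K × Reward D → ENNReal} (hf : Measurable f) :
    ∫⁻ x, f x ∂(step ν π n h) = ∫⁻ a, ∫⁻ r, f (a, r) ∂(ν.law a) ∂(π.next n h) := by
  unfold step
  rw [Kernel.lintegral_compProd _ _ _ hf]
  rfl

theorem lintegral_histLaw_zero (ν : Instance K D) (π : Algorithm K D)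
    (f : Hist K D 0 → ENNReal) :
    ∫⁻ h, f h ∂(histLaw ν π 0) = f (fun t => t.elim0) := by
  unfold histLaw
  exact lintegral_dirac _ _

theorem lintegral_histLaw_succ (ν : Instance K D) (π : Algorithm K D) {n : ℕ}
    {f : Hist K D (n + 1) → ENNReal} (hf : Measurable f) :
    ∫⁻ h, f h ∂(histLaw ν π (n + 1)) =
      ∫⁻ h, ∫⁻ x, f (Fin.snoc (α := fun _ => Fin K × Reward D) h x) ∂(step ν π n h)
        ∂(histLaw ν π n) := by
  conv_lhs => unfold histLaw
  rw [lintegral_map hf (measurable_snoc n)]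
  exact Measure.lintegral_compProd (hf.comp (measurable_snoc n))

/-- Expected sums over the rounds depend on the reward laws only through their conditional
expectations given the arms. -/
theorem lintegral_histLaw_sum (ν : Instance K D) (π : Algorithm K D)
    {G : Fin K × Reward D → ENNReal} (hG : Measurable G) (n : ℕ) :
    ∫⁻ h, ∑ t, G (h t) ∂(histLaw ν π n) =
      ∫⁻ h, ∑ t, (∫⁻ r, G ((h t).1, r) ∂(ν.law (h t).1)) ∂(histLaw ν π n) := by
  have hB : Measurable (fun x : Fin K × Reward D => ∫⁻ r, G (x.1, r) ∂(ν.law x.1)) :=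
    (measurable_of_countable (fun a : Fin K => ∫⁻ r, G (a, r) ∂(ν.law a))).comp measurable_fst
  have hsum : ∀ {F : Fin K × Reward D → ENNReal}, Measurable F → ∀ n,
      Measurable (fun h : Hist K D n => ∑ t, F (h t)) := fun hF n =>
    Finset.measurable_sum _ (fun t _ => hF.comp (measurable_pi_apply t))
  -- Used for `G` and for its average over the law of the arm: both have the same increment, as
  -- averaging a second time changes nothing.
  have key : ∀ {F : Fin K × Reward D → ENNReal}, Measurable F → ∀ n,
      ∫⁻ h, ∑ t, F (h t) ∂(histLaw ν π (n + 1)) = ∫⁻ h, ∑ t, F (h t) ∂(histLaw ν π n) +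
        ∫⁻ h, ∫⁻ a, ∫⁻ r, F (a, r) ∂(ν.law a) ∂(π.next n h) ∂(histLaw ν π n) := by
    intro F hF n
    rw [lintegral_histLaw_succ ν π (hsum hF _), ← lintegral_add_left (hsum hF n)]
    refine lintegral_congr fun h => ?_
    simp only [Fin.sum_univ_castSucc, Fin.snoc_castSucc, Fin.snoc_last]
    rw [lintegral_add_left measurable_const, lintegral_step ν π h hF]
    simp
  induction n with
  | zero => simp
  | succ n ih =>
    rw [key hG, key hB, ih]
    simp

/-- A product over the rounds of factors of conditional mean at most one has mean at most one. -/
theorem lintegral_histLaw_prod_le_one (ν : Instance K D) (π : Algorithm K D)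
    {G : Fin K × Reward D → ENNReal} (hG : Measurable G)
    (h1 : ∀ a, ∫⁻ r, G (a, r) ∂(ν.law a) ≤ 1) (n : ℕ) :
    ∫⁻ h, ∏ t, G (h t) ∂(histLaw ν π n) ≤ 1 := by
  have hprod : ∀ n, Measurable (fun h : Hist K D n => ∏ t, G (h t)) := fun n =>
    Finset.measurable_prod _ (fun t _ => hG.comp (measurable_pi_apply t))
  induction n with
  | zero => simp
  | succ n ih =>
    rw [lintegral_histLaw_succ ν π (hprod _)]
    refine le_trans (lintegral_mono fun h => ?_) ih
    simp only [Fin.prod_univ_castSucc, Fin.snoc_castSucc, Fin.snoc_last]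
    rw [lintegral_const_mul _ hG, lintegral_step ν π h hG]
    refine mul_le_of_le_one_right' ?_
    calc ∫⁻ a, ∫⁻ r, G (a, r) ∂(ν.law a) ∂(π.next n h) ≤ ∫⁻ _, 1 ∂(π.next n h) :=
          lintegral_mono h1
      _ = 1 := by simp

/-- Change of measure along the history: one-round density bounds multiply up. -/
theorem lintegral_histLaw_mul_prod_le (ν₁ ν₂ : Instance K D) (π : Algorithm K D)
    {G : Fin K × Reward D → ENNReal} (hG : Measurable G)
    (h12 : ∀ a, ∀ f : Reward D → ENNReal, Measurable f →
      ∫⁻ r, f r * G (a, r) ∂(ν₁.law a) ≤ ∫⁻ r, f r ∂(ν₂.law a)) (n : ℕ) :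
    ∀ f : Hist K D n → ENNReal, Measurable f →
      ∫⁻ h, f h * ∏ t, G (h t) ∂(histLaw ν₁ π n) ≤ ∫⁻ h, f h ∂(histLaw ν₂ π n) := by
  have hprod : ∀ n, Measurable (fun h : Hist K D n => ∏ t, G (h t)) := fun n =>
    Finset.measurable_prod _ (fun t _ => hG.comp (measurable_pi_apply t))
  induction n with
  | zero =>
    intro f _
    simp [lintegral_histLaw_zero]
  | succ n ih =>
    intro f hf
    rw [lintegral_histLaw_succ ν₁ π (f := fun h => f h * ∏ t, G (h t)) (hf.mul (hprod _)),
      lintegral_histLaw_succ ν₂ π hf]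
    have hf' := hf.comp (measurable_snoc n)
    -- The induction hypothesis is applied to the average of `f` over the last round under `ν₂`,
    -- which is why the induction runs over all `f`.
    refine le_trans (lintegral_mono fun h => ?_) (ih _ (hf'.lintegral_kernel_prod_right'
      (κ := step ν₂ π n)))
    have hfh : Measurable (fun x => f (Fin.snoc (α := fun _ => Fin K × Reward D) h x)) :=
      hf'.comp measurable_prodMk_left
    simp only [Fin.prod_univ_castSucc, Fin.snoc_castSucc, Fin.snoc_last]
    calc ∫⁻ x, f (Fin.snoc (α := fun _ => Fin K × Reward D) h x) * ((∏ t, G (h t)) * G x)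
            ∂(step ν₁ π n h)
        = (∫⁻ x, f (Fin.snoc (α := fun _ => Fin K × Reward D) h x) * G x ∂(step ν₁ π n h)) *
            ∏ t, G (h t) := by
          refine Eq.trans ?_ (lintegral_mul_const _ (hfh.mul hG))
          exact lintegral_congr fun x => by ring
      _ ≤ _ := by
          refine mul_le_mul' ?_ le_rfl
          refine (lintegral_step ν₁ π h (hfh.mul hG)).trans_le ?_
          rw [lintegral_step ν₂ π h hfh]
          exact lintegral_mono fun a => h12 a _ (hfh.comp measurable_prodMk_left)

/-! ### Pull counts and the two-point change of measure -/

/-- The number of times arm `j` is pulled in a history. -/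
noncomputable def pulls (j : Fin K) {n : ℕ} (h : Hist K D n) : ℝ :=
  ∑ t, if (h t).1 = j then 1 else 0

theorem measurable_arm_comp {E : Type*} [MeasurableSpace E] (g : Fin K → E) {n : ℕ} (t : Fin n) :
    Measurable (fun h : Hist K D n => g (h t).1) :=
  (measurable_of_countable g).comp (measurable_fst.comp (measurable_pi_apply t))

theorem integrable_sum_arm (ν : Instance K D) (π : Algorithm K D) (g : Fin K → ℝ) (n : ℕ) :
    Integrable (fun h : Hist K D n => ∑ t, g (h t).1) (histLaw ν π n) := by
  refine integrable_finsetSum _ fun t _ => ?_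
  refine Integrable.of_bound (measurable_arm_comp g t).aestronglyMeasurable (∑ a, ‖g a‖) ?_
  exact ae_of_all _ fun h =>
    Finset.single_le_sum (f := fun a => ‖g a‖) (fun a _ => norm_nonneg _) (Finset.mem_univ _)

theorem measurable_pulls (j : Fin K) (n : ℕ) : Measurable (pulls j : Hist K D n → ℝ) :=
  Finset.measurable_sum _ fun t _ =>
    measurable_arm_comp (fun a => if a = j then (1 : ℝ) else 0) t

theorem integrable_pulls (ν : Instance K D) (π : Algorithm K D) (j : Fin K) (n : ℕ) :
    Integrable (pulls j) (histLaw ν π n) :=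
  integrable_sum_arm ν π (fun a => if a = j then 1 else 0) n

theorem pulls_nonneg (j : Fin K) {n : ℕ} (h : Hist K D n) : 0 ≤ pulls j h :=
  Finset.sum_nonneg fun t _ => by split_ifs <;> norm_num

theorem pulls_le (j : Fin K) {n : ℕ} (h : Hist K D n) : pulls j h ≤ n := by
  calc pulls j h ≤ ∑ _t : Fin n, (1 : ℝ) :=
        Finset.sum_le_sum fun t _ => by split_ifs <;> norm_num
    _ = n := by simp

/-- If arm `j` is expected to be pulled at most `x` times on `ν₁`, then on an instance `ν₂` that
differs only in arm `j`, with `χ²`-type divergence at most `exp κ - 1`, the other arms are pulled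
at least `(T - 2 x) exp (-2 κ x) / 4` times. -/
theorem le_integral_sub_pulls (ν₁ ν₂ : Instance K D) (π : Algorithm K D) (j : Fin K)
    (hlaw : ∀ i, i ≠ j → ν₂.law i = ν₁.law i) {w : Reward D → ℝ} (hw : Measurable w)
    (hw0 : ∀ r, 0 < w r) {κ : ℝ} (hκ : 0 ≤ κ)
    (hle : ∀ f : Reward D → ENNReal, Measurable f →
      ∫⁻ r, f r * ENNReal.ofReal (w r) ∂(ν₁.law j) ≤ ∫⁻ r, f r ∂(ν₂.law j))
    (hinv : ∫⁻ r, ENNReal.ofReal (w r)⁻¹ ∂(ν₁.law j) ≤ ENNReal.ofReal (Real.exp κ))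
    {T : ℕ} {x : ℝ} (hx : 0 < x) (hxT : 2 * x < T)
    (hN : ∫ h, pulls j h ∂(histLaw ν₁ π T) ≤ x) :
    (T - 2 * x) * Real.exp (-(2 * κ * x)) / 4 ≤ ∫ h, (T - pulls j h) ∂(histLaw ν₂ π T) := by
  -- The product of `u` over the rounds acts as a likelihood ratio of `ν₂` to `ν₁`. The product of
  -- `v` is its inverse, damped by `exp (-κ)` per pull of `j` so that its mean is at most one.
  set u : Fin K × Reward D → ℝ := fun y => if y.1 = j then w y.2 else 1 with hu
  set v : Fin K × Reward D → ℝ := fun y => if y.1 = j then (w y.2)⁻¹ * Real.exp (-κ) else 1 with hv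
  have hset : MeasurableSet {y : Fin K × Reward D | y.1 = j} :=
    measurable_fst (measurableSet_singleton j)
  have hum : Measurable u := Measurable.ite hset (hw.comp measurable_snd) measurable_const
  have hvm : Measurable v :=
    Measurable.ite hset ((hw.comp measurable_snd).inv.mul_const _) measurable_const
  have hu0 : ∀ y, 0 < u y := fun y => by
    simp only [hu]; split_ifs; exacts [hw0 _, one_pos]
  have hv0 : ∀ y, 0 ≤ v y := fun y => by
    simp only [hv]; split_ifs
    exacts [mul_nonneg (inv_nonneg.2 (hw0 _).le) (Real.exp_pos _).le, zero_le_one]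
  have hV : ∫⁻ h, ∏ t, ENNReal.ofReal (v (h t)) ∂(histLaw ν₁ π T) ≤ 1 := by
    refine lintegral_histLaw_prod_le_one ν₁ π (G := fun y => ENNReal.ofReal (v y))
      hvm.ennreal_ofReal (fun a => ?_) T
    by_cases ha : a = j
    · subst ha
      simp only [hv, if_true]
      simp_rw [ENNReal.ofReal_mul (inv_nonneg.2 (hw0 _).le)]
      refine (lintegral_mul_const _ hw.inv.ennreal_ofReal).trans_le ?_
      calc _ ≤ ENNReal.ofReal (Real.exp κ) * ENNReal.ofReal (Real.exp (-κ)) :=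
            mul_le_mul' hinv le_rfl
        _ = 1 := by
          rw [← ENNReal.ofReal_mul (Real.exp_pos _).le, ← Real.exp_add]; simp
    · simp [hv, ha]
  set f : Hist K D T → ENNReal := fun h => ENNReal.ofReal (T - pulls j h) with hf
  have hfm : Measurable f := (measurable_const.sub (measurable_pulls j T)).ennreal_ofReal
  have hW : ∫⁻ h, f h * ∏ t, ENNReal.ofReal (u (h t)) ∂(histLaw ν₁ π T) ≤
      ∫⁻ h, f h ∂(histLaw ν₂ π T) := by
    refine lintegral_histLaw_mul_prod_le ν₁ ν₂ π (G := fun y => ENNReal.ofReal (u y))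
      hum.ennreal_ofReal (fun a g hg => ?_) T f hfm
    by_cases ha : a = j
    · subst ha
      simpa [hu] using hle g hg
    · simp [hu, ha, hlaw a ha]
  have hT : 0 < T - 2 * x := by linarith
  set C := Real.exp (2 * κ * x) / (T - 2 * x) with hC
  have hC0 : 0 < C := div_pos (Real.exp_pos _) hT
  -- Pointwise bound to be integrated under `ν₁`. If `j` is pulled at least `2 * x` times, the first
  -- term suffices; otherwise the other two do. The means of the first and last terms are at most
  -- `1/2` and `1/4`, leaving `1/4` for the middle one.
  have hpt : ∀ h : Hist K D T, (1 : ENNReal) ≤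
      (ENNReal.ofReal (2 * x)⁻¹ * ENNReal.ofReal (pulls j h) +
        ENNReal.ofReal C * (f h * ∏ t, ENNReal.ofReal (u (h t)))) +
        ENNReal.ofReal (1 / 4) * ∏ t, ENNReal.ofReal (v (h t)) := by
    intro h
    have hVW : ∏ t, v (h t) = (∏ t, u (h t))⁻¹ * Real.exp (-κ * pulls j h) := by
      rw [pulls, Finset.mul_sum, Real.exp_sum, ← Finset.prod_inv_distrib, ← Finset.prod_mul_distrib]
      refine Finset.prod_congr rfl fun t _ => ?_
      simp only [hu, hv]
      split_ifs <;> simp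
    have hP : 0 < ∏ t, u (h t) := Finset.prod_pos fun t _ => hu0 _
    have hN0 := pulls_nonneg j h
    have hNT := pulls_le j h
    rw [← ENNReal.ofReal_prod_of_nonneg fun t _ => (hu0 _).le,
      ← ENNReal.ofReal_prod_of_nonneg fun t _ => hv0 _, hVW, hf,
      ← ENNReal.ofReal_mul (p := T - pulls j h) (by linarith),
      ← ENNReal.ofReal_mul (p := (2 * x)⁻¹) (by positivity),
      ← ENNReal.ofReal_mul hC0.le, ← ENNReal.ofReal_mul (by norm_num),
      ← ENNReal.ofReal_add (by positivity) (by
        have : 0 ≤ (T : ℝ) - pulls j h := by linarith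
        positivity), ← ENNReal.ofReal_add (by
        have : 0 ≤ (T : ℝ) - pulls j h := by linarith
        positivity) (by positivity), ← ENNReal.ofReal_one]
    refine ENNReal.ofReal_le_ofReal ?_
    set P := ∏ t, u (h t)
    rcases le_or_gt (2 * x) (pulls j h) with hc | hc
    · have h1 : 1 ≤ (2 * x)⁻¹ * pulls j h := by
        rw [inv_mul_eq_div, le_div_iff₀ (by positivity)]; linarith
      have : 0 ≤ C * (((T : ℝ) - pulls j h) * P) := by
        have : 0 ≤ (T : ℝ) - pulls j h := by linarith
        positivity
      have : 0 ≤ 1 / 4 * (P⁻¹ * Real.exp (-κ * pulls j h)) := by positivity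
      linarith
    · have h1 : 0 ≤ (2 * x)⁻¹ * pulls j h := by positivity
      set Y := Real.exp (2 * κ * x) * P with hY
      have hY0 : 0 < Y := by positivity
      have h2 : Y ≤ C * (((T : ℝ) - pulls j h) * P) := by
        have : C * (((T : ℝ) - pulls j h) * P) = Y * ((T - pulls j h) / (T - 2 * x)) := by
          rw [hC, hY]; ring
        rw [this]
        refine le_mul_of_one_le_right hY0.le ?_
        rw [le_div_iff₀ hT]; linarith
      have h3 : Y⁻¹ ≤ P⁻¹ * Real.exp (-κ * pulls j h) := by
        rw [hY, mul_inv, mul_comm, ← Real.exp_neg]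
        gcongr
        nlinarith
      -- Arithmetic–geometric mean: the minimum is 1, attained at `Y = 1/2`.
      have h4 : 1 ≤ Y + 1 / 4 * Y⁻¹ := by
        have : Y + 1 / 4 * Y⁻¹ - 1 = (2 * Y - 1) ^ 2 / (4 * Y) := by field_simp; ring
        have : 0 ≤ (2 * Y - 1) ^ 2 / (4 * Y) := by positivity
        linarith
      linarith
  have hI := lintegral_mono (μ := histLaw ν₁ π T) hpt
  have hum' : Measurable (fun h : Hist K D T => ∏ t, ENNReal.ofReal (u (h t))) :=
    Finset.measurable_prod _ fun t _ => (hum.comp (measurable_pi_apply t)).ennreal_ofReal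
  have hvm' : Measurable (fun h : Hist K D T => ∏ t, ENNReal.ofReal (v (h t))) :=
    Finset.measurable_prod _ fun t _ => (hvm.comp (measurable_pi_apply t)).ennreal_ofReal
  have hfum : Measurable (fun h => f h * ∏ t, ENNReal.ofReal (u (h t))) := hfm.mul hum'
  rw [lintegral_add_right _ (hvm'.const_mul _),
    lintegral_add_right _ (hfum.const_mul _),
    lintegral_const_mul _ (measurable_pulls j T).ennreal_ofReal,
    lintegral_const_mul _ hfum, lintegral_const_mul _ hvm'] at hI
  have hE1 : ∫⁻ h, ENNReal.ofReal (pulls j h) ∂(histLaw ν₁ π T) ≤ ENNReal.ofReal x := by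
    rw [← ofReal_integral_eq_lintegral_ofReal (integrable_pulls ν₁ π j T)
      (ae_of_all _ (pulls_nonneg j))]
    exact ENNReal.ofReal_le_ofReal hN
  have hE2 : ∫⁻ h, f h ∂(histLaw ν₂ π T) =
      ENNReal.ofReal (∫ h, (T - pulls j h) ∂(histLaw ν₂ π T)) := by
    exact (ofReal_integral_eq_lintegral_ofReal
      ((integrable_const _).sub (integrable_pulls ν₂ π j T))
      (ae_of_all _ fun h => sub_nonneg.2 (pulls_le j h))).symm
  rw [hE2] at hW
  have hE : 0 ≤ ∫ h, (T - pulls j h) ∂(histLaw ν₂ π T) :=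
    integral_nonneg fun h => sub_nonneg.2 (pulls_le j h)
  set E := ∫ h, (T - pulls j h) ∂(histLaw ν₂ π T)
  have hfin : ENNReal.ofReal 1 ≤ ENNReal.ofReal ((2 * x)⁻¹ * x + C * E + 1 / 4) := by
    rw [ENNReal.ofReal_add (by positivity) (by norm_num),
      ENNReal.ofReal_add (by positivity) (by positivity), ENNReal.ofReal_mul (by positivity),
      ENNReal.ofReal_mul hC0.le]
    calc ENNReal.ofReal 1 = ∫⁻ _, 1 ∂(histLaw ν₁ π T) := by simp
      _ ≤ _ := hI
      _ ≤ _ := by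
        gcongr
        exact mul_le_of_le_one_right' hV
  have hreal := (ENNReal.ofReal_le_ofReal_iff (by positivity)).1 hfin
  have hx2 : (2 * x)⁻¹ * x = 1 / 2 := by field_simp
  have hCE : 1 / 4 ≤ C * E := by linarith
  rw [hC, div_mul_eq_mul_div, le_div_iff₀ hT] at hCE
  rw [Real.exp_neg, div_le_iff₀ (by norm_num), mul_inv_le_iff₀ (Real.exp_pos _)]
  linarith

/-! ### Pareto pseudo regret as scalar regret -/

theorem integrable_reward (ν : Instance K D) (i : Fin K) (d : Fin D) :
    Integrable (fun r : Reward D => r d) (ν.law i) := by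
  refine Integrable.of_bound (measurable_pi_apply d).aestronglyMeasurable 1 ?_
  filter_upwards [ν.bounded i] with r hr
  rw [Real.norm_eq_abs, abs_le]
  constructor <;> linarith [(hr d).1, (hr d).2]

theorem mean_nonneg (ν : Instance K D) (i : Fin K) (d : Fin D) : 0 ≤ ν.mean i d :=
  integral_nonneg_of_ae ((ν.bounded i).mono fun _ hr => (hr d).1)

/-- The tower property, obtained from the nonnegative identity `lintegral_histLaw_sum` because
rewards are almost surely nonnegative. -/
theorem expectedReward_eq (ν : Instance K D) (π : Algorithm K D) (T : ℕ) (d : Fin D) :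
    expectedReward ν π T d = ∫ h, ∑ t, ν.mean (h t).1 d ∂(histLaw ν π T) := by
  have hneg : MeasurableSet {y : Fin K × Reward D | y.2 d < 0} :=
    ((measurable_pi_apply d).comp measurable_snd) measurableSet_Iio
  have hmd : Measurable (fun y : Fin K × Reward D => y.2 d) :=
    (measurable_pi_apply d).comp measurable_snd
  have hnn : ∀ᵐ h ∂(histLaw ν π T), ∀ t, 0 ≤ (h t).2 d := by
    -- The expected number of rounds with a negative reward is zero.
    set G : Fin K × Reward D → ENNReal := fun y => if y.2 d < 0 then 1 else 0 with hG
    have hGm : Measurable G := Measurable.ite hneg measurable_const measurable_const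
    have h0 : ∫⁻ h, ∑ t, G (h t) ∂(histLaw ν π T) = 0 := by
      rw [lintegral_histLaw_sum ν π hGm]
      have : ∀ a, ∫⁻ r, G (a, r) ∂(ν.law a) = 0 := fun a => by
        refine (lintegral_eq_zero_iff (hGm.comp measurable_prodMk_left)).2 ?_
        filter_upwards [ν.bounded a] with r hr
        simp [hG, (hr d).1]
      simp [this]
    have hsm : Measurable (fun h : Hist K D T => ∑ t, G (h t)) :=
      Finset.measurable_sum _ fun t _ => hGm.comp (measurable_pi_apply t)
    rw [lintegral_eq_zero_iff hsm] at h0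
    filter_upwards [h0] with h hh t
    have := (Finset.sum_eq_zero_iff_of_nonneg (fun _ _ => zero_le)).1 hh t (Finset.mem_univ t)
    by_contra hlt
    simp [hG, not_le.1 hlt] at this
  unfold expectedReward
  rw [integral_eq_lintegral_of_nonneg_ae (hnn.mono fun h hh => Finset.sum_nonneg fun t _ => hh t)
      (Finset.measurable_sum _ fun t _ =>
        hmd.comp (measurable_pi_apply t)).aestronglyMeasurable,
    integral_eq_lintegral_of_nonneg_ae
      (ae_of_all _ fun h => Finset.sum_nonneg fun t _ => mean_nonneg ν _ d)
      (integrable_sum_arm ν π (fun a => ν.mean a d) T).aestronglyMeasurable]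
  congr 1
  calc ∫⁻ h, ENNReal.ofReal (∑ t, (h t).2 d) ∂(histLaw ν π T)
      = ∫⁻ h, ∑ t, ENNReal.ofReal ((h t).2 d) ∂(histLaw ν π T) :=
        lintegral_congr_ae (hnn.mono fun h hh =>
          ENNReal.ofReal_sum_of_nonneg fun t _ => hh t)
    _ = ∫⁻ h, ∑ t, (∫⁻ r, ENNReal.ofReal (r d) ∂(ν.law (h t).1)) ∂(histLaw ν π T) :=
        lintegral_histLaw_sum ν π (G := fun y => ENNReal.ofReal (y.2 d)) hmd.ennreal_ofReal T
    _ = _ := by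
        refine lintegral_congr fun h => ?_
        rw [ENNReal.ofReal_sum_of_nonneg fun t _ => mean_nonneg ν _ d]
        refine Finset.sum_congr rfl fun t _ => ?_
        exact (ofReal_integral_eq_lintegral_ofReal (integrable_reward ν _ d)
          ((ν.bounded _).mono fun _ hr => (hr d).1)).symm

/-- With means constant across coordinates, the Pareto pseudo regret is the usual pseudo regret. -/
theorem pseudoRegret_eq {ν : Instance K D} (hν : ν.ConstantMeans) (π : Algorithm K D) (d₀ : Fin D)
    {M : ℝ} {i₀ : Fin K} (hi₀ : ν.mean i₀ d₀ = M) (hM : ∀ i, ν.mean i d₀ ≤ M) {T : ℕ}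
    (hT : 0 < T) :
    pseudoRegret ν π T = ∫ h, ∑ t, (M - ν.mean (h t).1 d₀) ∂(histLaw ν π T) := by
  have hT' : (0 : ℝ) < T := by exact_mod_cast hT
  have hfront : ν.front T = {fun _ => T * M} := by
    ext v
    simp only [Instance.front, Set.mem_ofPred_eq, Set.mem_singleton_iff]
    constructor
    · rintro ⟨i, rfl, hi⟩
      have hmi : ν.mean i d₀ = M := by
        refine le_antisymm (hM i) (not_lt.1 fun hlt => hi i₀ ?_)
        have hlt' : ∀ d, ν.cumMean T i d < ν.cumMean T i₀ d := fun d => by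
          simp only [Instance.cumMean, Pi.smul_apply, smul_eq_mul]
          rw [hν i d d₀, hν i₀ d d₀, hi₀]
          gcongr
        exact Pi.lt_def.2 ⟨fun d => (hlt' d).le, d₀, hlt' d₀⟩
      ext d
      simp [Instance.cumMean, hν i d d₀, hmi]
    · rintro rfl
      refine ⟨i₀, ?_, fun j hj => ?_⟩
      · ext d
        simp [Instance.cumMean, hν i₀ d d₀, hi₀]
      · obtain ⟨-, d, hd⟩ := Pi.lt_def.1 hj
        simp only [Instance.cumMean, Pi.smul_apply, smul_eq_mul] at hd
        rw [hν i₀ d d₀, hν j d d₀, hi₀] at hd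
        exact absurd (lt_of_mul_lt_mul_left hd hT'.le) (not_lt.2 (hM j))
  have hint := integrable_sum_arm ν π (fun a => ν.mean a d₀) T
  set R := ∫ h, ∑ t, (M - ν.mean (h t).1 d₀) ∂(histLaw ν π T) with hR
  have hR0 : 0 ≤ R := integral_nonneg fun h => Finset.sum_nonneg fun t _ => sub_nonneg.2 (hM _)
  have hER : ∀ d, expectedReward ν π T d = T * M - R := fun d => by
    rw [expectedReward_eq]
    simp_rw [fun i => hν i d d₀]
    have : R = ∫ h, (T * M - ∑ t, ν.mean (h t).1 d₀) ∂(histLaw ν π T) := by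
      rw [hR]
      congr 1
      ext h
      simp [Finset.sum_sub_distrib]
    rw [this, integral_sub (integrable_const _) hint]
    simp
  unfold pseudoRegret paretoDist
  rw [hfront]
  -- Both vectors are on the diagonal, so incomparability forces equality and `R` is the only
  -- admissible shift.
  have : {ε : ℝ | 0 ≤ ε ∧ ∀ σ ∈ ({fun _ => T * M} : Set (Reward D)),
      Incomparable (fun d => expectedReward ν π T d + ε) σ} = {R} := by
    ext ε
    simp only [Incomparable, hER, Set.mem_singleton_iff, forall_eq, Set.mem_ofPred_eq]
    constructor
    · rintro ⟨-, ⟨-, h1⟩, -, h2⟩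
      linarith
    · rintro rfl
      exact ⟨hR0, ⟨d₀, by linarith⟩, d₀, by linarith⟩
  rw [this, csInf_singleton]

/-- Each pull of `j` costs at least `δ`, and no round has negative cost. -/
theorem mul_integral_pulls_le_pseudoRegret {ν : Instance K D} (hν : ν.ConstantMeans)
    (π : Algorithm K D) (d₀ : Fin D) {M : ℝ} {i₀ j : Fin K} (hi₀ : ν.mean i₀ d₀ = M)
    (hM : ∀ i, ν.mean i d₀ ≤ M) {δ : ℝ} (hδ : δ ≤ M - ν.mean j d₀) {T : ℕ} (hT : 0 < T) :
    δ * ∫ h, pulls j h ∂(histLaw ν π T) ≤ pseudoRegret ν π T := by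
  rw [pseudoRegret_eq hν π d₀ hi₀ hM hT, ← integral_const_mul]
  refine integral_mono ((integrable_pulls ν π j T).const_mul _)
    (integrable_sum_arm ν π (fun a => M - ν.mean a d₀) T) fun h => ?_
  simp only [pulls, Finset.mul_sum]
  refine Finset.sum_le_sum fun t _ => ?_
  split_ifs with ht
  · rw [ht]; linarith
  · linarith [hM (h t).1]

theorem mul_integral_sub_pulls_le_pseudoRegret {ν : Instance K D} (hν : ν.ConstantMeans)
    (π : Algorithm K D) (d₀ : Fin D) {M : ℝ} {j : Fin K} (hj : ν.mean j d₀ = M)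
    {δ : ℝ} (hδ0 : 0 ≤ δ) (hδ : ∀ i, i ≠ j → ν.mean i d₀ ≤ M - δ) {T : ℕ} (hT : 0 < T) :
    δ * ∫ h, (T - pulls j h) ∂(histLaw ν π T) ≤ pseudoRegret ν π T := by
  have hM : ∀ i, ν.mean i d₀ ≤ M := fun i => by
    by_cases hi : i = j
    · rw [hi, hj]
    · linarith [hδ i hi]
  rw [pseudoRegret_eq hν π d₀ hj hM hT, ← integral_const_mul]
  refine integral_mono (((integrable_const _).sub (integrable_pulls ν π j T)).const_mul _)
    (integrable_sum_arm ν π (fun a => M - ν.mean a d₀) T) fun h => ?_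
  have : (T : ℝ) - pulls j h = ∑ t, (1 - if (h t).1 = j then (1 : ℝ) else 0) := by
    simp [pulls, Finset.sum_sub_distrib]
  simp only [this, Finset.mul_sum]
  refine Finset.sum_le_sum fun t _ => ?_
  split_ifs with ht
  · linarith [hM (h t).1]
  · linarith [hδ _ ht]

/-! ### The regret dichotomy and consistency -/

/-- Two instances that differ only in one arm `j`, suboptimal on the first and best on the second:
if the first has regret at most `c log T`, the second has polynomial regret. -/
theorem exists_forall_pseudoRegret_dichotomy {ν₁ ν₂ : Instance K D} (hν₁ : ν₁.ConstantMeans)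
    (hν₂ : ν₂.ConstantMeans) (d₀ : Fin D) (j : Fin K) {i₁ : Fin K}
    (hi₁ : ∀ i, ν₁.mean i d₀ ≤ ν₁.mean i₁ d₀) {δ₁ δ₂ : ℝ} (hδ₁ : 0 < δ₁) (hδ₂ : 0 < δ₂)
    (hj₁ : δ₁ ≤ ν₁.mean i₁ d₀ - ν₁.mean j d₀)
    (hj₂ : ∀ i, i ≠ j → ν₂.mean i d₀ ≤ ν₂.mean j d₀ - δ₂)
    (hlaw : ∀ i, i ≠ j → ν₂.law i = ν₁.law i) {w : Reward D → ℝ} (hw : Measurable w)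
    (hw0 : ∀ r, 0 < w r) {κ : ℝ} (hκ : 0 ≤ κ)
    (hle : ∀ f : Reward D → ENNReal, Measurable f →
      ∫⁻ r, f r * ENNReal.ofReal (w r) ∂(ν₁.law j) ≤ ∫⁻ r, f r ∂(ν₂.law j))
    (hinv : ∫⁻ r, ENNReal.ofReal (w r)⁻¹ ∂(ν₁.law j) ≤ ENNReal.ofReal (Real.exp κ))
    {c : ℝ} (hc : 0 < c) (hκc : 4 * κ * c ≤ δ₁) :
    ∃ T₀ : ℕ, ∀ T, T₀ ≤ T → ∀ π : Algorithm K D, pseudoRegret ν₁ π T ≤ c * Real.log T →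
      (T : ℝ) ^ (1 / 4 : ℝ) ≤ pseudoRegret ν₂ π T := by
  have hlog : ∀ᶠ x : ℝ in atTop, 2 * (c * Real.log x / δ₁) ≤ x / 2 := by
    filter_upwards [Real.isLittleO_log_id_atTop.bound (c := δ₁ / (4 * c)) (by positivity),
      eventually_ge_atTop 1] with x hx hx1
    have h0 := Real.log_nonneg hx1
    simp only [id, Real.norm_eq_abs, abs_of_nonneg h0,
      abs_of_nonneg (zero_le_one.trans hx1)] at hx
    calc 2 * (c * Real.log x / δ₁) = 2 * c / δ₁ * Real.log x := by ring
      _ ≤ 2 * c / δ₁ * (δ₁ / (4 * c) * x) := by gcongr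
      _ = x / 2 := by field_simp; ring
  have hpow : ∀ᶠ x : ℝ in atTop, 8 / δ₂ ≤ x ^ (1 / 4 : ℝ) :=
    (tendsto_rpow_atTop (by norm_num)).eventually_ge_atTop _
  obtain ⟨T₀, hT₀⟩ := eventually_atTop.1
    (tendsto_natCast_atTop_atTop.eventually ((hlog.and hpow).and (eventually_gt_atTop (1 : ℝ))))
  refine ⟨T₀, fun T hT π hreg => ?_⟩
  obtain ⟨⟨h1, h2⟩, h3⟩ := hT₀ T hT
  have hT0 : (0 : ℝ) < T := by linarith
  have hTn : 0 < T := by exact_mod_cast hT0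
  have hlogT : 0 < Real.log T := Real.log_pos h3
  set x := c * Real.log T / δ₁ with hx
  have hx0 : 0 < x := by positivity
  have hN : ∫ h, pulls j h ∂(histLaw ν₁ π T) ≤ x := by
    rw [hx, le_div_iff₀ hδ₁, mul_comm]
    exact (mul_integral_pulls_le_pseudoRegret hν₁ π d₀ rfl hi₁ hj₁ hTn).trans hreg
  have key := le_integral_sub_pulls ν₁ ν₂ π j hlaw hw hw0 hκ hle hinv hx0 (by linarith) hN
  refine le_trans ?_ (mul_integral_sub_pulls_le_pseudoRegret hν₂ π d₀ rfl hδ₂.le hj₂ hTn)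
  -- The condition `4 * κ * c ≤ δ₁` is what makes `2 * κ * x` at most `log T / 2`.
  have hexp : (T : ℝ) ^ (-(1 / 2) : ℝ) ≤ Real.exp (-(2 * κ * x)) := by
    rw [Real.rpow_def_of_pos hT0]
    refine Real.exp_le_exp.2 ?_
    have : 2 * κ * x = 4 * κ * c / δ₁ * (Real.log T / 2) := by rw [hx]; ring
    have h4 : 4 * κ * c / δ₁ ≤ 1 := (div_le_one hδ₁).2 hκc
    nlinarith
  have hsplit : (T : ℝ) * (T : ℝ) ^ (-(1 / 2) : ℝ) =
      (T : ℝ) ^ (1 / 4 : ℝ) * (T : ℝ) ^ (1 / 4 : ℝ) := by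
    rw [← Real.rpow_one_add' hT0.le (by norm_num), ← Real.rpow_add hT0]
    norm_num
  -- One factor `T ^ (1/4)` out of `√T` absorbs the constant `8 / δ₂`.
  calc (T : ℝ) ^ (1 / 4 : ℝ) = δ₂ / 8 * (8 / δ₂ * (T : ℝ) ^ (1 / 4 : ℝ)) := by field_simp
    _ ≤ δ₂ / 8 * ((T : ℝ) ^ (1 / 4 : ℝ) * (T : ℝ) ^ (1 / 4 : ℝ)) := by gcongr
    _ = δ₂ * ((T / 2) * (T : ℝ) ^ (-(1 / 2) : ℝ) / 4) := by rw [← hsplit]; ring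
    _ ≤ δ₂ * ((T - 2 * x) * Real.exp (-(2 * κ * x)) / 4) := by
        gcongr <;> linarith
    _ ≤ _ := by gcongr

theorem Consistent.eventually_lt_pseudoRegret {π : ℕ → Algorithm K D} (hπ : Consistent π)
    {ν₁ ν₂ : Instance K D} (hν₂ : ν₂.ConstantMeans) {c : ℝ}
    (h : ∃ T₀ : ℕ, ∀ T, T₀ ≤ T → ∀ π : Algorithm K D, pseudoRegret ν₁ π T ≤ c * Real.log T →
      (T : ℝ) ^ (1 / 4 : ℝ) ≤ pseudoRegret ν₂ π T) :
    ∀ᶠ T : ℕ in atTop, c * Real.log T < pseudoRegret ν₁ (π T) T := by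
  obtain ⟨T₀, h⟩ := h
  filter_upwards [eventually_ge_atTop T₀, eventually_gt_atTop 0,
    (hπ ν₂ hν₂ (1 / 4) (by norm_num)).bound (c := 1 / 2) (by norm_num)] with T hT hT0 hb
  by_contra! hle
  have h1 := h T hT (π T) hle
  have h2 : (0 : ℝ) < (T : ℝ) ^ (1 / 4 : ℝ) := Real.rpow_pos_of_pos (by exact_mod_cast hT0) _
  rw [Real.norm_eq_abs, Real.norm_eq_abs, abs_of_pos h2] at hb
  linarith [le_abs_self (pseudoRegret ν₂ (π T) T)]

/-! ### Mixtures, Bernoulli arms and boosted arms -/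

/-- The mixture that replaces a reward vector by `(1, …, 1)` with probability `p`. -/
noncomputable def mixOne (p : ℝ) (μ : Measure (Reward D)) : Measure (Reward D) :=
  ENNReal.ofReal (1 - p) • μ + ENNReal.ofReal p • Measure.dirac 1

theorem lintegral_mixOne (p : ℝ) (μ : Measure (Reward D)) {f : Reward D → ENNReal}
    (hf : Measurable f) : ∫⁻ r, f r ∂(mixOne p μ) =
      ENNReal.ofReal (1 - p) * ∫⁻ r, f r ∂μ + ENNReal.ofReal p * f 1 := by
  simp [mixOne, lintegral_add_measure, lintegral_smul_measure, lintegral_dirac' _ hf]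

theorem isProbabilityMeasure_mixOne {p : ℝ} (h0 : 0 ≤ p) (h1 : p ≤ 1) (μ : Measure (Reward D))
    [IsProbabilityMeasure μ] : IsProbabilityMeasure (mixOne p μ) := by
  constructor
  simp only [mixOne, Measure.coe_add, Measure.coe_smul, Pi.add_apply, Pi.smul_apply, measure_univ,
    smul_eq_mul, mul_one]
  rw [← ENNReal.ofReal_add (by linarith) h0]
  simp

theorem ae_mixOne {p : ℝ} {μ : Measure (Reward D)}
    (h : ∀ᵐ r ∂μ, ∀ d, r d ∈ Set.Icc (0 : ℝ) 1) :
    ∀ᵐ r ∂(mixOne p μ), ∀ d, r d ∈ Set.Icc (0 : ℝ) 1 := by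
  rw [mixOne, ae_add_measure_iff]
  refine ⟨Measure.ae_smul_measure h _, Measure.ae_smul_measure ?_ _⟩
  rw [ae_dirac_eq]
  simp

theorem integral_mixOne {p : ℝ} (h0 : 0 ≤ p) (h1 : p ≤ 1) {μ : Measure (Reward D)} (d : Fin D)
    (h : Integrable (fun r : Reward D => r d) μ) :
    ∫ r, r d ∂(mixOne p μ) = (1 - p) * ∫ r, r d ∂μ + p := by
  rw [mixOne, integral_add_measure (h.smul_measure ENNReal.ofReal_ne_top)
    ((integrable_dirac (by simp)).smul_measure ENNReal.ofReal_ne_top), integral_smul_measure,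
    integral_smul_measure, integral_dirac, ENNReal.toReal_ofReal h0,
    ENNReal.toReal_ofReal (by linarith)]
  simp

/-- The law of the vector `(b, …, b)` for a Bernoulli variable `b` of mean `p`. -/
noncomputable def bernoulliLaw (D : ℕ) (p : ℝ) : Measure (Reward D) := mixOne p (Measure.dirac 0)

theorem integral_bernoulliLaw {p : ℝ} (h0 : 0 ≤ p) (h1 : p ≤ 1) (d : Fin D) :
    ∫ r, r d ∂(bernoulliLaw D p) = p := by
  rw [bernoulliLaw, integral_mixOne h0 h1 d (integrable_dirac (by simp)), integral_dirac]
  simp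

/-- Every arm has the law of `(b, …, b)` for a Bernoulli variable `b`. -/
noncomputable def bernoulliInstance (D : ℕ) (m : Fin K → ℝ) (hm : ∀ i, m i ∈ Set.Icc (0 : ℝ) 1) :
    Instance K D where
  law i := bernoulliLaw D (m i)
  isProb i := isProbabilityMeasure_mixOne (hm i).1 (hm i).2 _
  bounded i := ae_mixOne (by rw [ae_dirac_eq]; simp)

theorem bernoulliInstance_mean (m : Fin K → ℝ) (hm : ∀ i, m i ∈ Set.Icc (0 : ℝ) 1) (i : Fin K)
    (d : Fin D) : (bernoulliInstance D m hm).mean i d = m i :=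
  integral_bernoulliLaw (hm i).1 (hm i).2 d

/-- Replace the law of arm `j` by its mixture with `(1, …, 1)`. -/
noncomputable def boost (ν : Instance K D) (j : Fin K) {p : ℝ} (h0 : 0 ≤ p) (h1 : p ≤ 1) :
    Instance K D where
  law i := if i = j then mixOne p (ν.law j) else ν.law i
  isProb i := by
    split_ifs
    · exact isProbabilityMeasure_mixOne h0 h1 _
    · infer_instance
  bounded i := by
    split_ifs
    · exact ae_mixOne (ν.bounded j)
    · exact ν.bounded i

theorem boost_mean (ν : Instance K D) (j : Fin K) {p : ℝ} (h0 : 0 ≤ p) (h1 : p ≤ 1) (i : Fin K)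
    (d : Fin D) : (boost ν j h0 h1).mean i d =
      if i = j then (1 - p) * ν.mean j d + p else ν.mean i d := by
  unfold Instance.mean
  split_ifs with hi
  · rw [show (boost ν j h0 h1).law i = mixOne p (ν.law j) from if_pos hi]
    exact integral_mixOne h0 h1 d (integrable_reward ν j d)
  · rw [show (boost ν j h0 h1).law i = ν.law i from if_neg hi]

/-! ### Pairs of instances satisfying the dichotomy -/

/-- Two Bernoulli instances with small gaps, for which the dichotomy holds at the level `log T`. -/
theorem exists_pair_dichotomy (hK : 2 ≤ K) (hD : 1 ≤ D) :
    ∃ ν₁ ν₂ : Instance K D, ν₁.ConstantMeans ∧ ν₂.ConstantMeans ∧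
      ∃ T₀ : ℕ, ∀ T, T₀ ≤ T → ∀ π : Algorithm K D, pseudoRegret ν₁ π T ≤ 1 * Real.log T →
        (T : ℝ) ^ (1 / 4 : ℝ) ≤ pseudoRegret ν₂ π T := by
  let d₀ : Fin D := ⟨0, hD⟩
  let j : Fin K := ⟨0, by omega⟩
  let i₁ : Fin K := ⟨1, by omega⟩
  have hij : i₁ ≠ j := by simp [i₁, j]
  have hm₁ : ∀ i : Fin K, (if i = j then 15 / 32 else 31 / 64 : ℝ) ∈ Set.Icc (0 : ℝ) 1 :=
    fun i => by split_ifs <;> constructor <;> norm_num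
  have hm₂ : ∀ i : Fin K, (if i = j then 1 / 2 else 31 / 64 : ℝ) ∈ Set.Icc (0 : ℝ) 1 :=
    fun i => by split_ifs <;> constructor <;> norm_num
  have h10 : (1 : Reward D) ≠ 0 := fun h => one_ne_zero (congrFun h d₀)
  -- The density of Bernoulli `1/2` against Bernoulli `15/32`.
  set w : Reward D → ℝ := fun r => if r = 0 then 16 / 17 else 16 / 15 with hw
  have hwm : Measurable w :=
    Measurable.ite (measurableSet_singleton 0) measurable_const measurable_const
  have hlaw₁ : (bernoulliInstance D _ hm₁).law j = bernoulliLaw D (15 / 32) := by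
    simp [bernoulliInstance]
  have hlaw₂ : (bernoulliInstance D _ hm₂).law j = bernoulliLaw D (1 / 2) := by
    simp [bernoulliInstance]
  refine ⟨bernoulliInstance D _ hm₁, bernoulliInstance D _ hm₂, fun i d d' => ?_,
    fun i d d' => ?_, ?_⟩
  · simp only [bernoulliInstance_mean]
  · simp only [bernoulliInstance_mean]
  -- The mean of `1 / w` is `17/32 * 17/16 + 15/32 * 15/16 = 1 + 1/256 ≤ exp (1/256)`, so `4 * κ * c
  -- = δ₁` holds exactly at `c = 1`.
  refine exists_forall_pseudoRegret_dichotomy (δ₁ := 1 / 64) (δ₂ := 1 / 64) (κ := 1 / 256)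
    (w := w) (i₁ := i₁) (fun i d d' => ?_) (fun i d d' => ?_) d₀ j (fun i => ?_) (by norm_num)
    (by norm_num) ?_ (fun i hi => ?_) (fun i hi => ?_) hwm (fun r => ?_) (by norm_num)
    (fun f hf => ?_) ?_ one_pos (by norm_num)
  · simp only [bernoulliInstance_mean]
  · simp only [bernoulliInstance_mean]
  · simp only [bernoulliInstance_mean, if_neg hij]
    split_ifs <;> norm_num
  · simp only [bernoulliInstance_mean, if_neg hij, if_true]
    norm_num
  · simp only [bernoulliInstance_mean, if_neg hi, if_true]
    norm_num
  · simp [bernoulliInstance, hi]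
  · simp only [hw]
    split_ifs <;> norm_num
  · rw [hlaw₁, hlaw₂, bernoulliLaw, bernoulliLaw, lintegral_mixOne _ _ hf,
      lintegral_mixOne _ _ (f := fun r => f r * ENNReal.ofReal (w r)) (hf.mul hwm.ennreal_ofReal),
      lintegral_dirac, lintegral_dirac, mul_left_comm, mul_left_comm (ENNReal.ofReal (15 / 32)),
      ← ENNReal.ofReal_mul (by norm_num), ← ENNReal.ofReal_mul (by norm_num), mul_comm (f 0),
      mul_comm (f 1)]
    simp only [hw, if_true, if_neg h10]
    norm_num
  · rw [hlaw₁, bernoulliLaw, lintegral_mixOne _ _ (f := fun r => ENNReal.ofReal (w r)⁻¹)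
      hwm.inv.ennreal_ofReal, lintegral_dirac, ← ENNReal.ofReal_mul (by norm_num),
      ← ENNReal.ofReal_mul (by norm_num)]
    simp only [hw, if_true, if_neg h10]
    rw [← ENNReal.ofReal_add (by norm_num) (by norm_num)]
    refine ENNReal.ofReal_le_ofReal (le_trans ?_ (Real.add_one_le_exp _))
    norm_num

/-- A suboptimal arm whose law can be boosted beyond the best mean forces logarithmic regret. -/
theorem exists_boost_dichotomy {ν : Instance K D} (hν : ν.ConstantMeans) (d₀ : Fin D)
    (hlt : ∀ i, ν.mean i d₀ < 1) (hne : ∃ i j, ν.mean i ≠ ν.mean j) :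
    ∃ (ν' : Instance K D) (c : ℝ), ν'.ConstantMeans ∧ 0 < c ∧
      ∃ T₀ : ℕ, ∀ T, T₀ ≤ T → ∀ π : Algorithm K D, pseudoRegret ν π T ≤ c * Real.log T →
        (T : ℝ) ^ (1 / 4 : ℝ) ≤ pseudoRegret ν' π T := by
  obtain ⟨a, b, hab⟩ := hne
  have : Nonempty (Fin K) := ⟨a⟩
  obtain ⟨i₁, hi₁⟩ := Finite.exists_max (fun i => ν.mean i d₀)
  obtain ⟨j, hj⟩ : ∃ j, ν.mean j d₀ < ν.mean i₁ d₀ := by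
    by_contra! hcon
    refine hab (funext fun d => ?_)
    rw [hν a d d₀, hν b d d₀]
    linarith [hcon a, hcon b, hi₁ a, hi₁ b]
  set M := ν.mean i₁ d₀ with hMdef
  set m := ν.mean j d₀ with hmdef
  have hM1 : M < 1 := hlt i₁
  have hm1 : 0 < 1 - m := by linarith
  -- Chosen so that the boosted mean `1 - q * (1 - m)` is `(1 + M) / 2`, halfway between the best
  -- mean and 1. The old law times `q` is below the new one, so the constant `w = q` serves as
  -- density bound, with `κ = log q⁻¹`.
  set q := (1 - M) / (2 * (1 - m)) with hq
  have hq0 : 0 < q := div_pos (by linarith) (by linarith)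
  have hq1 : q < 1 := by rw [hq, div_lt_one (by linarith)]; linarith
  have hqm : q * (1 - m) = (1 - M) / 2 := by rw [hq]; field_simp
  have h0 : (0 : ℝ) ≤ 1 - q := by linarith
  have h1 : 1 - q ≤ 1 := by linarith
  have hκ : 0 < Real.log q⁻¹ := Real.log_pos (one_lt_inv₀ hq0 |>.2 hq1)
  have hc : 0 < (M - m) / (4 * Real.log q⁻¹) := div_pos (by linarith) (by positivity)
  have hconst : (boost ν j h0 h1).ConstantMeans := fun i d d' => by
    rw [boost_mean, boost_mean, hν j d d', hν i d d']
  refine ⟨boost ν j h0 h1, (M - m) / (4 * Real.log q⁻¹), hconst, hc, ?_⟩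
  refine exists_forall_pseudoRegret_dichotomy (δ₁ := M - m) (δ₂ := (1 - M) / 2)
    (κ := Real.log q⁻¹) (w := fun _ => q) hν hconst d₀ j hi₁ (by linarith) (by linarith) le_rfl
    (fun i hi => ?_) (fun i hi => ?_) measurable_const (fun _ => hq0) hκ.le (fun f hf => ?_) ?_ hc
    (le_of_eq (by exact mul_div_cancel₀ _ (by positivity)))
  · rw [boost_mean, boost_mean, if_neg hi, if_pos rfl]
    have := hi₁ i
    nlinarith
  · simp [boost, hi]
  · have : (boost ν j h0 h1).law j = mixOne (1 - q) (ν.law j) := by simp [boost]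
    rw [this, lintegral_mixOne _ _ hf, lintegral_mul_const _ hf, mul_comm, sub_sub_cancel]
    exact le_self_add
  · rw [Real.exp_log (by positivity)]
    simp

end MOMAB

theorem theorem5 (K D : ℕ) (hK : 2 ≤ K) (hD : 1 ≤ D) :
    -- an instance on which every consistent algorithm has regret larger than `log T`
    (∃ ν : MOMAB.Instance K D, ν.ConstantMeans ∧
      ∀ π : ℕ → MOMAB.Algorithm K D, MOMAB.Consistent π →
        ∀ᶠ T : ℕ in atTop, Real.log T < MOMAB.pseudoRegret ν (π T) T) ∧
    -- two instances such that every algorithm has regret larger than `log T` on one of them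
    (∃ ν₁ ν₂ : MOMAB.Instance K D, ν₁.ConstantMeans ∧ ν₂.ConstantMeans ∧
      ∃ T₀ : ℕ, ∀ T : ℕ, T₀ ≤ T → ∀ π : MOMAB.Algorithm K D,
        Real.log T < max (MOMAB.pseudoRegret ν₁ π T) (MOMAB.pseudoRegret ν₂ π T)) ∧
    -- order `log T` on every nontrivial instance with mean vectors constant across coordinates
    (∀ ν : MOMAB.Instance K D, ν.ConstantMeans →
      (∀ i d, ν.mean i d < 1) → (∃ i j, ν.mean i ≠ ν.mean j) →
      ∃ c : ℝ, 0 < c ∧ ∀ π : ℕ → MOMAB.Algorithm K D, MOMAB.Consistent π →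
        (c : EReal) ≤ liminf
          (fun T : ℕ => ((MOMAB.pseudoRegret ν (π T) T / Real.log T : ℝ) : EReal)) atTop) := by
  obtain ⟨ν₁, ν₂, hν₁, hν₂, hdich⟩ := MOMAB.exists_pair_dichotomy hK hD
  refine ⟨⟨ν₁, hν₁, fun π hπ => ?_⟩, ⟨ν₁, ν₂, hν₁, hν₂, ?_⟩, fun ν hν hlt hne => ?_⟩
  · simpa only [one_mul] using hπ.eventually_lt_pseudoRegret hν₂ hdich
  · obtain ⟨T₀, hT₀⟩ := hdich
    have hlog : ∀ᶠ x : ℝ in atTop, Real.log x < x ^ (1 / 4 : ℝ) := by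
      filter_upwards [(isLittleO_log_rpow_atTop (r := 1 / 4) (by norm_num)).bound
        (c := 1 / 2) (by norm_num), eventually_gt_atTop 0] with x hx hx0
      have h2 : 0 < x ^ (1 / 4 : ℝ) := Real.rpow_pos_of_pos hx0 _
      rw [Real.norm_eq_abs, Real.norm_eq_abs, abs_of_pos h2] at hx
      linarith [le_abs_self (Real.log x)]
    obtain ⟨T₁, hT₁⟩ := eventually_atTop.1 (tendsto_natCast_atTop_atTop.eventually hlog)
    refine ⟨max T₀ T₁, fun T hT π => ?_⟩
    -- The dichotomy is uniform over algorithms at each fixed `T`, so consistency plays no role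
    -- here.
    rcases le_or_gt (MOMAB.pseudoRegret ν₁ π T) (1 * Real.log T) with h | h
    · exact lt_max_of_lt_right
        ((hT₁ T (le_trans (le_max_right _ _) hT)).trans_le
          (hT₀ T (le_trans (le_max_left _ _) hT) π h))
    · exact lt_max_of_lt_left (by simpa only [one_mul] using h)
  · obtain ⟨ν', c, hν', hc, hd⟩ :=
      MOMAB.exists_boost_dichotomy hν ⟨0, hD⟩ (fun i => hlt i _) hne
    refine ⟨c, hc, fun π hπ => le_liminf_of_le (by isBoundedDefault) ?_⟩
    filter_upwards [hπ.eventually_lt_pseudoRegret hν' hd, eventually_gt_atTop 1] with T hT hT1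
    have : 0 < Real.log T := Real.log_pos (by exact_mod_cast hT1)
    exact EReal.coe_le_coe_iff.2 ((le_div_iff₀ this).2 hT.le)
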